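/- Let $n\in\mathbb N$, let $U\subset\mathbb R^n$ be open and connected, and let $x:U\to\mathbb R^{n+1}$ be an injective immersion of class $C^r$, $r\ge 3$, with a continuous unit normal field $\xi$ (the Euclidean normalization) and nowhere vanishing Gaussian curvature. Subscripts $/i$ denote partial derivatives, and repeated indices are summed. A relative $C^s$-normalization ($1\le s<r$) is a $C^s$-map $y:U\to\mathbb R^{n+1}$ such that at every point $y$ is not tangent to the hypersurface while all $y_{/i}$ are tangent to it. Its support function is $q=\langle\xi,y\rangle$; its covector $X$ is defined by $\langle X,x_{/i}\rangle=0$ $(i=1,\dots,n)$ and $\langle X,y\rangle=1$; its relative metric is $G_{ij}=\langle X,x_{/ij}\rangle$. The metric $G$ is a nondegenerate, possibly indefinite, quadratic form. Let $(G^{ij})$ be its inverse, $\nabla^G$ its Levi-Civita covariant derivative, and $\Delta^G f=G^{ij}\nabla^G_i\nabla^G_j f$ its second Beltrami operator, applied componentwise to vector-valued $f$. If $r\ge4$, the Darboux tensor is $A_{ijk}=\langle X,\nabla^G_k\nabla^G_j x_{/i}\rangle$ and the Tchebychev vector field is $T=\frac1n A_{ijk}G^{jk}G^{im}x_{/m}$.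 Let $y_1,y_2$ be two relative $C^s$-normalizations of $x$, with support functions $q_1,q_2$, relative metrics $G_1,G_2$ and (if $r\ge4$) Tchebychev vector fields $T_1,T_2$. (a) If $n=2$, then $q_1^{-1}\Delta^{G_1}x=q_2^{-1}\Delta^{G_2}x$ and $q_1^{-1}\Delta^{G_1}\xi=q_2^{-1}\Delta^{G_2}\xi$ on $U$; that is, $q^{-1}\Delta^Gx$ and $q^{-1}\Delta^G\xi$ do not depend on the relative normalization. (b) If $n\ge3$, each of the conditions (i), (iii) and, if $r\ge4$, also (ii) is equivalent to (iv): (i) $\left\langle \frac{\Delta^{G_1}x}{q_1}-\frac{\Delta^{G_2}x}{q_2},\,d\xi\right\rangle=0$ at every point of $U$; (ii) $\left\langle \frac{T_1}{q_1}-\frac{T_2}{q_2},\,d\xi\right\rangle=0$ at every point of $U$; (iii) $\left\langle \frac{\Delta^{G_1}\xi}{q_1}-\frac{\Delta^{G_2}\xi}{q_2},\,dx\right\rangle=0$ at every point of $U$; (iv) there is a constant $\lambda\ne0$ with $q_1=\lambda q_2$ on $U$. -/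

import Mathlib

open scoped BigOperators

noncomputable section

namespace RelGeom

/-- The parameter space and the ambient spaces: Euclidean `k`-space. -/
abbrev E (k : ℕ) : Type := EuclideanSpace ℝ (Fin k)

variable {n : ℕ} {F : Type*} [NormedAddCommGroup F] [NormedSpace ℝ F]

/-- The partial derivative `∂f/∂uⁱ`. -/
def pd (i : Fin n) (f : E n → F) (u : E n) : F :=
  fderiv ℝ f u (EuclideanSpace.single i 1)

/-! Covariant calculus of a nondegenerate quadratic form `Q = Q_ij duⁱ duʲ`, given by its
matrix of components. -/

/-- The Christoffel symbols `Γᵏᵢⱼ` of the Levi-Civita connection of `Q`. -/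
def christoffel (Q : E n → Matrix (Fin n) (Fin n) ℝ) (k i j : Fin n) (u : E n) : ℝ :=
  (1 / 2) * ∑ l, (Q u)⁻¹ k l *
    (pd i (fun v => Q v j l) u + pd j (fun v => Q v i l) u - pd l (fun v => Q v i j) u)

/-- The covariant derivative `∇_j V_i` of a covariant 1-tensor (with values in `F`). -/
def covDeriv₁ (Q : E n → Matrix (Fin n) (Fin n) ℝ) (V : Fin n → E n → F)
    (j i : Fin n) (u : E n) : F :=
  pd j (V i) u - ∑ m, christoffel Q m j i u • V m u

/-- The covariant derivative `∇_k W_ji` of a covariant 2-tensor (with values in `F`). -/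
def covDeriv₂ (Q : E n → Matrix (Fin n) (Fin n) ℝ) (W : Fin n → Fin n → E n → F)
    (k j i : Fin n) (u : E n) : F :=
  pd k (W j i) u - ∑ m, christoffel Q m k j u • W m i u - ∑ m, christoffel Q m k i u • W j m u

/-- The second Beltrami differential operator `Δ^Q f = Q^{ij} ∇_i ∇_j f`, for functions with
values in `F` (for a vector-valued function it acts componentwise). -/
def beltrami₂ (Q : E n → Matrix (Fin n) (Fin n) ℝ) (f : E n → F) (u : E n) : F :=
  ∑ i, ∑ j, (Q u)⁻¹ i j • covDeriv₁ Q (fun m => pd m f) i j u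

/-! Hypersurfaces and relative normalizations. -/

/-- The tangent vector space of the hypersurface `x` at the point with parameter `u`. -/
def tangentSpace (x : E n → E (n + 1)) (u : E n) : Submodule ℝ (E (n + 1)) :=
  LinearMap.range (fderiv ℝ x u : E n →ₗ[ℝ] E (n + 1))

/-- `x` is an injective immersion of class `C^r` of the open set `U`. -/
structure IsHypersurface (r : WithTop ℕ∞) (U : Set (E n)) (x : E n → E (n + 1)) : Prop where
  isOpen : IsOpen U
  contDiffOn : ContDiffOn ℝ r x U
  injOn : Set.InjOn x U
  immersion : ∀ u ∈ U, Function.Injective (fderiv ℝ x u)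

/-- `ξ` is a Euclidean normalization of `x` on `U`: a continuous field of unit normals
(two choices for a connected `U`, differing by the sign). -/
structure IsEuclideanNormalization (U : Set (E n)) (x ξ : E n → E (n + 1)) : Prop where
  continuousOn : ContinuousOn ξ U
  norm_eq_one : ∀ u ∈ U, ‖ξ u‖ = 1
  orthogonal : ∀ u ∈ U, ∀ i, inner ℝ (ξ u) (pd i x u) = 0

/-- The components `g_ij` of the first fundamental form. -/
def firstForm (x : E n → E (n + 1)) (u : E n) : Matrix (Fin n) (Fin n) ℝ :=
  Matrix.of fun i j => inner ℝ (pd i x u) (pd j x u)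

/-- The components `h_ij` of the second fundamental form. -/
def secondForm (x ξ : E n → E (n + 1)) (u : E n) : Matrix (Fin n) (Fin n) ℝ :=
  Matrix.of fun i j => inner ℝ (ξ u) (pd j (pd i x) u)

/-- The Gaussian curvature `K = det h / det g`. -/
def gaussCurvature (x ξ : E n → E (n + 1)) (u : E n) : ℝ :=
  (secondForm x ξ u).det / (firstForm x u).det

/-- `y` is a relative `C^s`-normalization of `x` on `U`. -/
structure IsRelativeNormalization (s : WithTop ℕ∞) (U : Set (E n)) (x y : E n → E (n + 1)) :
    Prop where
  contDiffOn : ContDiffOn ℝ s y U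
  not_mem_tangentSpace : ∀ u ∈ U, y u ∉ tangentSpace x u
  pd_mem_tangentSpace : ∀ u ∈ U, ∀ i, pd i y u ∈ tangentSpace x u

/-- The support function `q = ⟨ξ, y⟩`. -/
def support (ξ y : E n → E (n + 1)) (u : E n) : ℝ := inner ℝ (ξ u) (y u)

/-- The covector `X` of the tangent hyperplane: the (unique) vector with
`⟨X, x_{/i}⟩ = 0` for all `i` and `⟨X, y⟩ = 1`. -/
def covector (x y : E n → E (n + 1)) (u : E n) : E (n + 1) :=
  Classical.epsilon fun X : E (n + 1) =>
    (∀ i, inner ℝ X (pd i x u) = 0) ∧ inner ℝ X (y u) = 1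

/-- The relative metric `G_ij = ⟨X, x_{/ij}⟩`. -/
def relMetric (x y : E n → E (n + 1)) (u : E n) : Matrix (Fin n) (Fin n) ℝ :=
  Matrix.of fun i j => inner ℝ (covector x y u) (pd j (pd i x) u)

/-- The Darboux tensor `A_ijk = ⟨X, ∇^G_k ∇^G_j x_{/i}⟩`. -/
def darboux (x y : E n → E (n + 1)) (i j k : Fin n) (u : E n) : ℝ :=
  inner ℝ (covector x y u)
    (covDeriv₂ (relMetric x y) (covDeriv₁ (relMetric x y) (fun m => pd m x)) k j i u)

/-- The Tchebychev vector field `T = (1/n) A_ijk G^{jk} G^{im} x_{/m}`. -/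
def tchebychev (x y : E n → E (n + 1)) (u : E n) : E (n + 1) :=
  (1 / (n : ℝ)) • ∑ i, ∑ j, ∑ k, ∑ m,
    (darboux x y i j k u * (relMetric x y u)⁻¹ j k * (relMetric x y u)⁻¹ i m) • pd m x u

/-- `⟨V, df⟩ = 0` at every point of `U`. -/
def InnerDiffVanishes (U : Set (E n)) (V f : E n → E (n + 1)) : Prop :=
  ∀ u ∈ U, ∀ w : E n, inner ℝ (V u) (fderiv ℝ f u w) = 0

end RelGeom

end

namespace RelGeom

variable {n : ℕ} {F : Type*} [NormedAddCommGroup F] [NormedSpace ℝ F]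

/-! Partial derivatives. -/

/-! The covector of a normalization is `X = ξ / q`, so every relative metric is conformal to the
second fundamental form: `G = h / q`. All dependence on the normalization therefore passes through
`q`. Conformal change of the Christoffel symbols, traced with `h⁻¹`, gives `q⁻¹ Δ^G f = Δ^h f -
(n-2)/2 · L^m f_{/m}` with `L = grad_h log q` (`beltrami₂_conformal`). Similarly `q⁻¹ T` is a vector
free of `q` plus `(n+2)/(2n) · L^m x_{/m}` (`tchebychev_conformal`). For `n = 2` the first
correction vanishes, which is (a). For `n ≥ 3` the difference of two normalizations is a nonzero
multiple of `(L₁ - L₂)^m z_{/m}` with `z = x` or `z = ξ`. Since `⟨x_{/i}, ξ_{/j}⟩ = -h_ij`, pairing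
with the other differential lowers the index and leaves a multiple of `d log |q₁/q₂|`. This vanishes
on a connected set exactly when `q₁/q₂` is constant (`innerDiffVanishes_iff_proportional`). What
remains is regularity: `ξ` is only assumed continuous and `y` may be merely `C^1`, yet `ξ` and `q`
turn out to be `C^2` (`contDiffAt_normal`, `contDiffAt_support`). -/

theorem contDiffAt_pd {k m : WithTop ℕ∞} {f : E n → F} {u : E n} (hf : ContDiffAt ℝ k f u)
    (hm : m + 1 ≤ k) (i : Fin n) : ContDiffAt ℝ m (pd i f) u :=
  (hf.fderiv_right hm).clm_apply contDiffAt_const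

theorem fderiv_eq_sum_pd (f : E n → F) (u w : E n) : fderiv ℝ f u w = ∑ i, w i • pd i f u := by
  have hw : w = ∑ i, w i • EuclideanSpace.single i (1 : ℝ) := by
    ext j
    simp [Finset.sum_apply, Pi.single_apply]
  conv_lhs => rw [hw]
  simp [pd, map_sum]

theorem pd_congr {f g : E n → F} {u : E n} (h : f =ᶠ[nhds u] g) (i : Fin n) :
    pd i f u = pd i g u := by
  simp only [pd, h.fderiv_eq]

theorem pd_comm {f : E n → F} {u : E n} (hf : ContDiffAt ℝ 2 f u) (i j : Fin n) :
    pd i (pd j f) u = pd j (pd i f) u := by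
  have hd : DifferentiableAt ℝ (fderiv ℝ f) u :=
    (hf.fderiv_right (m := 1) (by norm_num)).differentiableAt (by norm_num)
  have key (a b : Fin n) : pd a (pd b f) u =
      fderiv ℝ (fderiv ℝ f) u (EuclideanSpace.single a 1) (EuclideanSpace.single b 1) := by
    have : pd b f = fun v => fderiv ℝ f v (EuclideanSpace.single b 1) := rfl
    simp only [this]
    simp only [pd]
    rw [fderiv_clm_apply hd (differentiableAt_const _)]
    simp
  rw [key, key]
  exact (hf.isSymmSndFDerivAt (by simp)) _ _

theorem pd_inner {f g : E n → E (n + 1)} {u : E n} (hf : DifferentiableAt ℝ f u)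
    (hg : DifferentiableAt ℝ g u) (i : Fin n) :
    pd i (fun v => inner ℝ (f v) (g v)) u = inner ℝ (f u) (pd i g u) + inner ℝ (pd i f u) (g u) :=
  fderiv_inner_apply ℝ hf hg _

theorem pd_sub {f g : E n → F} {u : E n} (hf : DifferentiableAt ℝ f u)
    (hg : DifferentiableAt ℝ g u) (i : Fin n) :
    pd i (fun v => f v - g v) u = pd i f u - pd i g u := by
  simp only [pd]
  rw [fderiv_fun_sub hf hg]
  simp

theorem pd_sum_smul {a : Fin n → E n → ℝ} {g : Fin n → E n → F} {u : E n}
    (ha : ∀ m, DifferentiableAt ℝ (a m) u) (hg : ∀ m, DifferentiableAt ℝ (g m) u) (i : Fin n) :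
    pd i (fun v => ∑ m, a m v • g m v) u =
      ∑ m, (a m u • pd i (g m) u + pd i (a m) u • g m u) := by
  simp only [pd]
  rw [fderiv_fun_sum fun m _ => (ha m).fun_smul (hg m)]
  simp only [sum_apply]
  refine Finset.sum_congr rfl fun m _ => ?_
  rw [fderiv_fun_smul (ha m) (hg m)]
  simp

theorem pd_inv_mul {q h : E n → ℝ} {u : E n} (hq : DifferentiableAt ℝ q u)
    (hh : DifferentiableAt ℝ h u) (h0 : q u ≠ 0) (i : Fin n) :
    pd i (fun v => (q v)⁻¹ * h v) u = (q u)⁻¹ * pd i h u - ((q u)⁻¹) ^ 2 * pd i q u * h u := by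
  simp only [pd]
  have := (((hasDerivAt_inv h0).comp_hasFDerivAt u hq.hasFDerivAt).mul hh.hasFDerivAt).fderiv
  rw [show (fun v => (q v)⁻¹ * h v) = (Inv.inv ∘ q) * h from rfl, this]
  simp
  ring

/-! Regularity of the inverse matrix. -/

theorem contDiffAt_det {ι : Type*} [Fintype ι] [DecidableEq ι] {k : WithTop ℕ∞}
    {M : E n → Matrix ι ι ℝ} {u : E n}
    (hM : ∀ i j, ContDiffAt ℝ k (fun v => M v i j) u) : ContDiffAt ℝ k (fun v => (M v).det) u := by
  simp only [Matrix.det_apply']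
  exact ContDiffAt.sum fun σ _ => contDiffAt_const.mul (contDiffAt_prod fun i _ => hM _ _)

/-- Cramer's rule: each entry is a determinant divided by `det M`. The formula also holds at
singular matrices, where both sides are zero, so invertibility matters only at `u`. -/
theorem contDiffAt_inv_apply {ι : Type*} [Fintype ι] [DecidableEq ι] {k : WithTop ℕ∞}
    {M : E n → Matrix ι ι ℝ} {u : E n}
    (hM : ∀ i j, ContDiffAt ℝ k (fun v => M v i j) u) (hdet : (M u).det ≠ 0) (i j : ι) :
    ContDiffAt ℝ k (fun v => (M v)⁻¹ i j) u := by
  simp only [Matrix.inv_def, Ring.inverse_eq_inv', Matrix.smul_apply, smul_eq_mul,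
    Matrix.adjugate_apply]
  refine ((contDiffAt_det hM).inv hdet).mul (contDiffAt_det fun a b => ?_)
  by_cases h : a = j
  · subst h
    simpa using contDiffAt_const
  · simpa [Matrix.updateRow_ne h] using hM a b

/-! Normal vectors and the covector of a relative normalization. -/

section Normal

variable {x ξ y : E n → E (n + 1)} {u : E n}

theorem inner_eq_zero_of_mem_tangentSpace {w t : E (n + 1)}
    (hw : ∀ i, inner ℝ w (pd i x u) = 0) (ht : t ∈ tangentSpace x u) : inner ℝ w t = 0 := by
  obtain ⟨a, rfl⟩ := ht
  simp [fderiv_eq_sum_pd, inner_sum, inner_smul_right, hw]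

theorem pd_mem_tangentSpace_self (i : Fin n) : pd i x u ∈ tangentSpace x u :=
  ⟨EuclideanSpace.single i 1, rfl⟩

/-- The tangent space has dimension `n` in an `(n+1)`-dimensional space, so its orthogonal
complement is a line. -/
theorem eq_inner_smul_of_orthogonal (him : Function.Injective (fderiv ℝ x u))
    {ν w : E (n + 1)} (hν : ‖ν‖ = 1) (hνx : ∀ i, inner ℝ ν (pd i x u) = 0)
    (hw : ∀ i, inner ℝ w (pd i x u) = 0) : w = (inner ℝ ν w : ℝ) • ν := by
  have hmem {z : E (n + 1)} (hz : ∀ i, inner ℝ z (pd i x u) = 0) : z ∈ (tangentSpace x u)ᗮ :=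
    (Submodule.mem_orthogonal' _ _).2 fun t ht => inner_eq_zero_of_mem_tangentSpace hz ht
  have hT : Module.finrank ℝ (tangentSpace x u) = n := by
    have := LinearMap.finrank_range_of_inj
      (f := (fderiv ℝ x u : E n →ₗ[ℝ] E (n + 1))) him
    rw [finrank_euclideanSpace_fin] at this
    exact this
  have hO : Module.finrank ℝ (tangentSpace x u)ᗮ = 1 := by
    have := Submodule.finrank_add_finrank_orthogonal (tangentSpace x u)
    rw [hT] at this
    simpa using this
  have hne : (⟨ν, hmem hνx⟩ : (tangentSpace x u)ᗮ) ≠ 0 := by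
    intro h
    have h0 : ν = 0 := congrArg Subtype.val h
    simp [h0] at hν
  obtain ⟨c, hc⟩ := (finrank_eq_one_iff_of_nonzero' _ hne).1 hO ⟨w, hmem hw⟩
  have hc' : c • ν = w := congrArg Subtype.val hc
  rw [← hc', inner_smul_right, real_inner_self_eq_norm_sq, hν]
  simp

theorem mem_tangentSpace_of_inner_eq_zero (him : Function.Injective (fderiv ℝ x u))
    {ν w : E (n + 1)} (hν : ‖ν‖ = 1) (hνx : ∀ i, inner ℝ ν (pd i x u) = 0)
    (hw : inner ℝ ν w = 0) : w ∈ tangentSpace x u := by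
  rw [← Submodule.orthogonal_orthogonal (tangentSpace x u)]
  refine (Submodule.mem_orthogonal _ _).2 fun z hz => ?_
  rw [eq_inner_smul_of_orthogonal him hν hνx (w := z) fun i =>
    (Submodule.mem_orthogonal' _ _).1 hz _ (pd_mem_tangentSpace_self i), inner_smul_left, hw,
    mul_zero]

/-- The vector `q⁻¹ ξ` shows that the choice in `covector` is satisfiable; one-dimensionality of the
normal line makes it the only candidate. -/
theorem covector_eq (him : Function.Injective (fderiv ℝ x u)) (hν : ‖ξ u‖ = 1)
    (hνx : ∀ i, inner ℝ (ξ u) (pd i x u) = 0) (hq : support ξ y u ≠ 0) :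
    covector x y u = (support ξ y u)⁻¹ • ξ u := by
  have hs : (∀ i, inner ℝ (covector x y u) (pd i x u) = 0) ∧ inner ℝ (covector x y u) (y u) = 1 :=
    Classical.epsilon_spec (p := fun X : E (n + 1) =>
      (∀ i, inner ℝ X (pd i x u) = 0) ∧ inner ℝ X (y u) = 1)
      ⟨(support ξ y u)⁻¹ • ξ u, fun i => by rw [inner_smul_left, hνx, mul_zero], by
        rw [inner_smul_left]; exact inv_mul_cancel₀ hq⟩
  have h1 := eq_inner_smul_of_orthogonal him hν hνx hs.1
  have h2 := hs.2
  rw [h1, inner_smul_left] at h2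
  have h3 : (inner ℝ (ξ u) (covector x y u) : ℝ) = (support ξ y u)⁻¹ :=
    eq_inv_of_mul_eq_one_left h2
  rw [h1, h3]

end Normal

/-! Regularity of the Euclidean normal, of the second form and of the support function. -/

section Regularity

variable {x ξ y : E n → E (n + 1)} {U : Set (E n)} {r s : WithTop ℕ∞} {u : E n}

theorem IsHypersurface.contDiffAt (hx : IsHypersurface r U x) (hu : u ∈ U) : ContDiffAt ℝ r x u :=
  hx.contDiffOn.contDiffAt (hx.isOpen.mem_nhds hu)

/-- Division by zero yields zero, so a nonzero quotient already forces a nonzero denominator. -/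
theorem firstForm_det_ne_zero (hK : gaussCurvature x ξ u ≠ 0) : (firstForm x u).det ≠ 0 :=
  fun h => hK (by simp [gaussCurvature, h])

theorem secondForm_det_ne_zero (hK : gaussCurvature x ξ u ≠ 0) : (secondForm x ξ u).det ≠ 0 :=
  fun h => hK (by simp [gaussCurvature, h])

/-- Projecting the frozen vector `ξ u` to the normal line at `v` is as regular as `dx` and gives `⟨ξ
v, ξ u⟩ ξ v`. Continuity of `ξ` keeps the factor positive near `u`, so normalizing recovers `ξ v`
with the right sign. -/
theorem contDiffAt_normal {k : WithTop ℕ∞} (hx : IsHypersurface r U x) (hk : k + 1 ≤ r)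
    (hξ : IsEuclideanNormalization U x ξ) (hu : u ∈ U) (hg : (firstForm x u).det ≠ 0) :
    ContDiffAt ℝ k ξ u := by
  have hxi (i : Fin n) : ContDiffAt ℝ k (pd i x) u := contDiffAt_pd (hx.contDiffAt hu) hk i
  have hgk (i j : Fin n) : ContDiffAt ℝ k (fun v => firstForm x v i j) u :=
    (hxi i).inner ℝ (hxi j)
  -- the orthogonal projection of the fixed vector `ξ u` to the normal lines
  let N : E n → E (n + 1) := fun v =>
    ξ u - ∑ i, ∑ j, ((firstForm x v)⁻¹ i j * inner ℝ (ξ u) (pd i x v)) • pd j x v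
  have hN : ContDiffAt ℝ k N u :=
    contDiffAt_const.sub (ContDiffAt.sum fun i _ => ContDiffAt.sum fun j _ =>
      ((contDiffAt_inv_apply hgk hg i j).mul (contDiffAt_const.inner ℝ (hxi i))).smul (hxi j))
  have hNu : N u = ξ u := by simp [N, hξ.orthogonal u hu]
  have hdet : ∀ᶠ v in nhds u, (firstForm x v).det ≠ 0 :=
    (contDiffAt_det hgk).continuousAt.eventually_ne hg
  have hξc : ContinuousAt ξ u := hξ.continuousOn.continuousAt (hx.isOpen.mem_nhds hu)
  have hpos : ∀ᶠ v in nhds u, 0 < (inner ℝ (ξ v) (ξ u) : ℝ) := by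
    refine (hξc.inner continuousAt_const).eventually_const_lt ?_
    show (0 : ℝ) < inner ℝ (ξ u) (ξ u)
    rw [real_inner_self_eq_norm_sq, hξ.norm_eq_one u hu]
    norm_num
  have hev : ξ =ᶠ[nhds u] fun v => ‖N v‖⁻¹ • N v := by
    filter_upwards [hdet, hpos, hx.isOpen.mem_nhds hu] with v hv hp hvU
    have hinv := Matrix.nonsing_inv_mul _ (isUnit_iff_ne_zero.2 hv)
    have hNx (l : Fin n) : inner ℝ (N v) (pd l x v) = 0 := by
      have (i : Fin n) : ∑ j, (firstForm x v)⁻¹ i j * inner ℝ (ξ u) (pd i x v) *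
          inner ℝ (pd j x v) (pd l x v) = if i = l then inner ℝ (ξ u) (pd i x v) else 0 := by
        have h := congrFun (congrFun hinv i) l
        rw [Matrix.mul_apply, Matrix.one_apply] at h
        calc _ = (∑ j, (firstForm x v)⁻¹ i j * firstForm x v j l) * inner ℝ (ξ u) (pd i x v) := by
              rw [Finset.sum_mul]
              exact Finset.sum_congr rfl fun j _ => by simp only [firstForm, Matrix.of_apply]; ring
          _ = _ := by rw [h]; split_ifs <;> simp
      simp only [N, inner_sub_left, sum_inner, inner_smul_left, conj_trivial, this]
      simp
    have hnv := hξ.norm_eq_one v hvU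
    have h1 := eq_inner_smul_of_orthogonal (hx.immersion v hvU) hnv (hξ.orthogonal v hvU) hNx
    have h2 : (inner ℝ (ξ v) (N v) : ℝ) = inner ℝ (ξ v) (ξ u) := by
      simp [N, inner_sub_right, inner_sum, inner_smul_right, hξ.orthogonal v hvU]
    rw [h2] at h1
    have h3 : ‖N v‖ = inner ℝ (ξ v) (ξ u) := by
      rw [h1, norm_smul, hnv, mul_one, Real.norm_of_nonneg hp.le]
    rw [h3, h1, inv_smul_smul₀ hp.ne']
  have hne : N u ≠ 0 := by
    rw [hNu]
    intro h
    simpa [h] using hξ.norm_eq_one u hu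
  exact (((hN.norm ℝ hne).inv (norm_ne_zero_iff.2 hne)).smul hN).congr_of_eventuallyEq hev

theorem contDiffAt_secondForm {k : WithTop ℕ∞} (hx : ContDiffAt ℝ r x u) (hk : k + 1 + 1 ≤ r)
    (hξ : ContDiffAt ℝ k ξ u) (i j : Fin n) : ContDiffAt ℝ k (fun v => secondForm x ξ v i j) u :=
  hξ.inner ℝ (contDiffAt_pd (contDiffAt_pd hx hk i) le_rfl j)

theorem secondForm_symm (hx : ContDiffAt ℝ 2 x u) (i j : Fin n) :
    secondForm x ξ u i j = secondForm x ξ u j i := by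
  simp only [secondForm, Matrix.of_apply, pd_comm hx i j]

/-- Weingarten's relation, from differentiating `⟨ξ, x_{/i}⟩ = 0`. -/
theorem inner_pd_pd_normal (hx : IsHypersurface r U x) (hr : 2 ≤ r)
    (hξ : IsEuclideanNormalization U x ξ) (hu : u ∈ U) (hξd : DifferentiableAt ℝ ξ u)
    (i j : Fin n) : inner ℝ (pd i x u) (pd j ξ u) = -secondForm x ξ u i j := by
  have hxd : DifferentiableAt ℝ (pd i x) u :=
    (contDiffAt_pd (m := 1) (hx.contDiffAt hu) (by simpa [one_add_one_eq_two] using hr)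
      i).differentiableAt (by norm_num)
  have h0 : (fun v => (inner ℝ (ξ v) (pd i x v) : ℝ)) =ᶠ[nhds u] fun _ => 0 := by
    filter_upwards [hx.isOpen.mem_nhds hu] with v hv using hξ.orthogonal v hv i
  have h1 := pd_congr h0 j
  rw [pd_inner hξd hxd] at h1
  have h2 : pd j (fun _ : E n => (0 : ℝ)) u = 0 := by simp [pd]
  rw [h2] at h1
  rw [real_inner_comm]
  simp only [secondForm, Matrix.of_apply]
  linarith

theorem support_ne_zero (hx : IsHypersurface r U x) (hξ : IsEuclideanNormalization U x ξ)
    (hy : IsRelativeNormalization s U x y) (hu : u ∈ U) : support ξ y u ≠ 0 := fun h =>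
  hy.not_mem_tangentSpace u hu (mem_tangentSpace_of_inner_eq_zero (hx.immersion u hu)
    (hξ.norm_eq_one u hu) (hξ.orthogonal u hu) h)

theorem IsRelativeNormalization.contDiffAt (hy : IsRelativeNormalization s U x y) (hs : 1 ≤ s)
    (hU : IsOpen U) (hu : u ∈ U) : ContDiffAt ℝ 1 y u :=
  (hy.contDiffOn.contDiffAt (hU.mem_nhds hu)).of_le hs

/-- One derivative is gained over `y`: as `dy` is tangent, `⟨ξ, dy⟩ = 0` and `dq = ⟨dξ, y⟩`, a
product of `C^1` factors. -/
theorem contDiffAt_support (hU : IsOpen U) (hξ : IsEuclideanNormalization U x ξ) (hs : 1 ≤ s)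
    (hy : IsRelativeNormalization s U x y) (hu : u ∈ U) (hξd : ∀ v ∈ U, ContDiffAt ℝ 2 ξ v) :
    ContDiffAt ℝ 2 (support ξ y) u := by
  refine (contDiffAt_succ_iff_hasFDerivAt (n := 1)).2
    ⟨fun v => (innerSL ℝ (y v)).comp (fderiv ℝ ξ v), ⟨U, hU.mem_nhds hu, fun v hv => ?_⟩, ?_⟩
  · have hξv := (hξd v hv).differentiableAt (by norm_num)
    have hyv := (hy.contDiffAt hs hU hv).differentiableAt (by norm_num)
    refine (hξv.hasFDerivAt.inner ℝ hyv.hasFDerivAt).congr_fderiv ?_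
    ext w
    have h0 : inner ℝ (ξ v) (fderiv ℝ y v w) = 0 := by
      simp [fderiv_eq_sum_pd, inner_sum, inner_smul_right,
        inner_eq_zero_of_mem_tangentSpace (hξ.orthogonal v hv) (hy.pd_mem_tangentSpace v hv _)]
    simp [h0, real_inner_comm]
  · exact ((innerSL ℝ).contDiff.contDiffAt.comp u (hy.contDiffAt hs hU hu)).clm_comp
      ((hξd u hu).fderiv_right (by norm_num))

theorem relMetric_eventuallyEq (hx : IsHypersurface r U x) (hξ : IsEuclideanNormalization U x ξ)
    (hy : IsRelativeNormalization s U x y) (hu : u ∈ U) :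
    relMetric x y =ᶠ[nhds u] fun v => (support ξ y v)⁻¹ • secondForm x ξ v := by
  filter_upwards [hx.isOpen.mem_nhds hu] with v hv
  ext i j
  simp only [relMetric, secondForm, Matrix.of_apply, Matrix.smul_apply,
    covector_eq (hx.immersion v hv) (hξ.norm_eq_one v hv) (hξ.orthogonal v hv)
      (support_ne_zero hx hξ hy hv), inner_smul_left, conj_trivial, smul_eq_mul]

end Regularity

/-! Conformal change of a nondegenerate quadratic form. -/

section Conformal

variable {Q H : E n → Matrix (Fin n) (Fin n) ℝ} {q : E n → ℝ} {u : E n}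

/-- The contravariant components `H^{ml} q_l / q` of the logarithmic gradient of `q`. -/
noncomputable def logGrad (H : E n → Matrix (Fin n) (Fin n) ℝ) (q : E n → ℝ) (m : Fin n) (u : E n) : ℝ :=
  ∑ l, (H u)⁻¹ m l * ((q u)⁻¹ * pd l q u)

theorem inv_smul_inv {M : Matrix (Fin n) (Fin n) ℝ} {c : ℝ} (hc : c ≠ 0) (hM : M.det ≠ 0) :
    (c⁻¹ • M)⁻¹ = c • M⁻¹ := by
  refine Matrix.inv_eq_right_inv ?_
  rw [Matrix.smul_mul, Matrix.mul_smul, Matrix.mul_nonsing_inv _ (isUnit_iff_ne_zero.2 hM),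
    inv_smul_smul₀ hc]

theorem inv_apply_symm {M : Matrix (Fin n) (Fin n) ℝ} (hs : ∀ i j, M i j = M j i) (i j : Fin n) :
    M⁻¹ i j = M⁻¹ j i := by
  have h : M.transpose = M := Matrix.ext fun i j => hs j i
  have h2 := Matrix.transpose_nonsing_inv M
  rw [h] at h2
  exact congrFun (congrFun h2 j) i

theorem sum_inv_mul {M : Matrix (Fin n) (Fin n) ℝ} (hM : M.det ≠ 0) (i j : Fin n) :
    ∑ k, M⁻¹ i k * M k j = if i = j then 1 else 0 := by
  have h := congrFun (congrFun (Matrix.nonsing_inv_mul _ (isUnit_iff_ne_zero.2 hM)) i) j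
  rwa [Matrix.mul_apply, Matrix.one_apply] at h

theorem sum_inv_mul' {M : Matrix (Fin n) (Fin n) ℝ} (hM : M.det ≠ 0)
    (hs : ∀ i j, M i j = M j i) (i j : Fin n) :
    ∑ k, M⁻¹ i k * M j k = if i = j then 1 else 0 := by
  rw [← sum_inv_mul hM]
  exact Finset.sum_congr rfl fun k _ => by rw [hs j k]

theorem sum_sum_inv_mul {M : Matrix (Fin n) (Fin n) ℝ} (hM : M.det ≠ 0)
    (hs : ∀ i j, M i j = M j i) : ∑ i, ∑ j, M⁻¹ i j * M i j = n := by
  simp [sum_inv_mul' hM hs]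

theorem pd_conformal (hQ : Q =ᶠ[nhds u] fun v => (q v)⁻¹ • H v) (hq : DifferentiableAt ℝ q u)
    (hH : ∀ i j, DifferentiableAt ℝ (fun v => H v i j) u) (h0 : q u ≠ 0) (k i j : Fin n) :
    pd k (fun v => Q v i j) u =
      (q u)⁻¹ * pd k (fun v => H v i j) u - ((q u)⁻¹) ^ 2 * pd k q u * H u i j := by
  rw [← pd_inv_mul hq (hH i j) h0]
  exact pd_congr (hQ.mono fun v hv => by simp [hv]) k

theorem christoffel_conformal (hQ : Q =ᶠ[nhds u] fun v => (q v)⁻¹ • H v)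
    (hq : DifferentiableAt ℝ q u) (hH : ∀ i j, DifferentiableAt ℝ (fun v => H v i j) u)
    (h0 : q u ≠ 0) (hdet : (H u).det ≠ 0) (hs : ∀ i j, H u i j = H u j i) (k i j : Fin n) :
    christoffel Q k i j u = christoffel H k i j u - (1 / 2) * (q u)⁻¹ *
      ((if k = j then 1 else 0) * pd i q u + (if k = i then 1 else 0) * pd j q u)
      + (1 / 2) * H u i j * logGrad H q k u := by
  simp only [christoffel, pd_conformal hQ hq hH h0, hQ.eq_of_nhds, inv_smul_inv h0 hdet,
    Matrix.smul_apply, smul_eq_mul, logGrad]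
  -- Expanding the Kronecker deltas as `H⁻¹ H` turns both sides into sums over `l` that agree term
  -- by term.
  rw [← sum_inv_mul' hdet hs k j, ← sum_inv_mul' hdet hs k i]
  simp only [Finset.sum_mul, Finset.mul_sum, ← Finset.sum_sub_distrib, ← Finset.sum_add_distrib]
  refine Finset.sum_congr rfl fun l _ => ?_
  field_simp
  ring

/-- The factor `q⁻¹` cancels the `q` in `Q⁻¹ = q H⁻¹`, so second derivatives of `f` agree on both
sides and `f` needs no regularity. In the trace of the Christoffel difference the two delta terms
give `L` and the metric term gives `-(n/2) L`. -/
theorem beltrami₂_conformal (hQ : Q =ᶠ[nhds u] fun v => (q v)⁻¹ • H v)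
    (hq : DifferentiableAt ℝ q u) (hH : ∀ i j, DifferentiableAt ℝ (fun v => H v i j) u)
    (h0 : q u ≠ 0) (hdet : (H u).det ≠ 0) (hs : ∀ i j, H u i j = H u j i) (f : E n → F) :
    (q u)⁻¹ • beltrami₂ Q f u =
      beltrami₂ H f u + (-((n : ℝ) - 2) / 2) • ∑ m, logGrad H q m u • pd m f u := by
  have hcoef (m : Fin n) : ∑ i, ∑ j, (H u)⁻¹ i j *
      (christoffel H m i j u - christoffel Q m i j u) = -((n : ℝ) - 2) / 2 * logGrad H q m u := by
    have h1 : ∑ i, ∑ j, (H u)⁻¹ i j * ((if m = j then 1 else 0) * pd i q u) =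
        ∑ l, (H u)⁻¹ m l * pd l q u := by
      simp [inv_apply_symm hs _ m]
    have h2 : ∑ i, ∑ j, (H u)⁻¹ i j * ((if m = i then 1 else 0) * pd j q u) =
        ∑ l, (H u)⁻¹ m l * pd l q u := by
      rw [Finset.sum_comm]
      simp
    calc _ = (1 / 2) * (q u)⁻¹ *
          (∑ i, ∑ j, (H u)⁻¹ i j * ((if m = j then 1 else 0) * pd i q u) +
            ∑ i, ∑ j, (H u)⁻¹ i j * ((if m = i then 1 else 0) * pd j q u)) -
          (1 / 2) * logGrad H q m u * ∑ i, ∑ j, (H u)⁻¹ i j * H u i j := by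
          simp only [Finset.mul_sum, ← Finset.sum_sub_distrib, ← Finset.sum_add_distrib,
            christoffel_conformal hQ hq hH h0 hdet hs]
          refine Finset.sum_congr rfl fun i _ => Finset.sum_congr rfl fun j _ => ?_
          ring
      _ = _ := by
          rw [h1, h2, sum_sum_inv_mul hdet hs]
          have : ∑ l, (H u)⁻¹ m l * pd l q u = q u * logGrad H q m u := by
            rw [logGrad, Finset.mul_sum]
            exact Finset.sum_congr rfl fun l _ => by field_simp
          rw [this]
          field_simp
          ring
  rw [Finset.smul_sum]
  -- With the gradient term written back as a trace, the identity holds separately for each pair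
  -- `(i, j)`.
  simp only [smul_smul, ← hcoef]
  simp only [beltrami₂, covDeriv₁, hQ.eq_of_nhds, inv_smul_inv h0 hdet, Finset.smul_sum,
    Matrix.smul_apply, smul_smul, smul_eq_mul, mul_assoc, inv_mul_cancel_left₀ h0, smul_sub, Finset.sum_smul]
  rw [Finset.sum_comm (γ := Fin n) (s := Finset.univ) (f := fun m i => ∑ j, ((H u)⁻¹ i j *
      (christoffel H m i j u - christoffel Q m i j u)) • pd m f u), ← Finset.sum_add_distrib]
  refine Finset.sum_congr rfl fun i _ => ?_
  rw [Finset.sum_comm (γ := Fin n) (s := Finset.univ) (f := fun m j => ((H u)⁻¹ i j *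
      (christoffel H m i j u - christoffel Q m i j u)) • pd m f u), ← Finset.sum_add_distrib]
  refine Finset.sum_congr rfl fun j _ => ?_
  simp only [mul_sub, sub_smul, Finset.sum_sub_distrib]
  abel

/-- Lowering the index gives the symbols of the first kind, which are free of `Q⁻¹`. -/
theorem sum_christoffel_mul (hdet : (Q u).det ≠ 0) (hs : ∀ i j, Q u i j = Q u j i)
    (i j l : Fin n) : ∑ m, christoffel Q m i j u * Q u m l =
      (1 / 2) * (pd i (fun v => Q v j l) u + pd j (fun v => Q v i l) u
        - pd l (fun v => Q v i j) u) := by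
  simp only [christoffel, mul_assoc, ← Finset.mul_sum, Finset.sum_mul]
  rw [Finset.sum_comm]
  have (k : Fin n) (c : ℝ) : ∑ m, (Q u)⁻¹ m k * (c * Q u m l) = if k = l then c else 0 := by
    have h := sum_inv_mul hdet k l
    calc _ = (∑ m, (Q u)⁻¹ k m * Q u m l) * c := by
          rw [Finset.sum_mul]
          exact Finset.sum_congr rfl fun m _ => by rw [inv_apply_symm hs m k]; ring
      _ = _ := by rw [h]; split_ifs <;> simp
  simp only [this]
  simp

theorem contDiffAt_christoffel {k : WithTop ℕ∞}
    (hQ : ∀ i j, ContDiffAt ℝ (k + 1) (fun v => Q v i j) u) (hdet : (Q u).det ≠ 0)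
    (m i j : Fin n) : ContDiffAt ℝ k (christoffel Q m i j) u :=
  contDiffAt_const.mul (ContDiffAt.sum fun l _ =>
    (contDiffAt_inv_apply (fun a b => (hQ a b).of_le le_self_add) hdet m l).mul
      (((contDiffAt_pd (hQ j l) le_rfl i).add (contDiffAt_pd (hQ i l) le_rfl j)).sub
        (contDiffAt_pd (hQ i j) le_rfl l)))

end Conformal

/-! The Darboux tensor and the Tchebychev vector field. -/

section Darboux

variable {x y : E n → E (n + 1)} {u : E n}

/-- Since `X` annihilates tangent vectors, only three first-kind Christoffel symbols of `G` survive;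
in their sum the negative terms cancel half of the positive ones. -/
theorem darboux_eq (hX : ∀ i, inner ℝ (covector x y u) (pd i x u) = 0)
    (hx : ContDiffAt ℝ 3 x u) (hG : ∀ i j, ContDiffAt ℝ 2 (fun v => relMetric x y v i j) u)
    (hdet : (relMetric x y u).det ≠ 0)
    (hs : ∀ᶠ v in nhds u, ∀ i j, relMetric x y v i j = relMetric x y v j i) (i j k : Fin n) :
    darboux x y i j k u = inner ℝ (covector x y u) (pd k (pd j (pd i x)) u) -
      (1 / 2) * (pd i (fun v => relMetric x y v j k) u + pd j (fun v => relMetric x y v i k) u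
        + pd k (fun v => relMetric x y v i j) u) := by
  have hΓ (m a b : Fin n) : DifferentiableAt ℝ (christoffel (relMetric x y) m a b) u :=
    (contDiffAt_christoffel (k := 1) (by simpa [one_add_one_eq_two] using hG) hdet m a b
      ).differentiableAt (by norm_num)
  have hx1 (m : Fin n) : ContDiffAt ℝ 2 (pd m x) u := contDiffAt_pd hx (by norm_num) m
  have hx2 (a b : Fin n) : DifferentiableAt ℝ (pd a (pd b x)) u :=
    (contDiffAt_pd (m := 1) (hx1 b) (by norm_num) a).differentiableAt (by norm_num)
  have hx1' (m : Fin n) : DifferentiableAt ℝ (pd m x) u := (hx1 m).differentiableAt (by norm_num)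
  have hsu := hs.self_of_nhds
  have hsw (c a b : Fin n) :
      pd c (fun v => relMetric x y v a b) u = pd c (fun v => relMetric x y v b a) u :=
    pd_congr (hs.mono fun v hv => hv a b) c
  have hXX (a b : Fin n) : inner ℝ (covector x y u) (pd a (pd b x) u) = relMetric x y u b a := rfl
  have hW (a b : Fin n) : inner ℝ (covector x y u)
      (covDeriv₁ (relMetric x y) (fun m => pd m x) a b u) = relMetric x y u b a := by
    simp [covDeriv₁, inner_sub_right, inner_sum, inner_smul_right, hX, hXX]
  -- Derivatives of the Christoffel symbols multiply tangent vectors and are killed by `X`; their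
  -- existence is still needed for the product rule.
  have hdW : inner ℝ (covector x y u)
      (pd k (covDeriv₁ (relMetric x y) (fun m => pd m x) j i) u) =
      inner ℝ (covector x y u) (pd k (pd j (pd i x)) u) -
        ∑ m, christoffel (relMetric x y) m j i u * relMetric x y u m k := by
    have : covDeriv₁ (relMetric x y) (fun m => pd m x) j i = fun v => pd j (pd i x) v -
        ∑ m, christoffel (relMetric x y) m j i v • pd m x v := rfl
    rw [this, pd_sub (hx2 j i) (DifferentiableAt.fun_sum fun m _ => (hΓ m j i).fun_smul (hx1' m)),
      pd_sum_smul (fun m => hΓ m j i) hx1']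
    simp [inner_sub_right, inner_sum, inner_add_right, inner_smul_right, hX, hXX]
  have hr (a : Fin n) : ∑ m, christoffel (relMetric x y) m k a u *
      relMetric x y u i m = ∑ m, christoffel (relMetric x y) m k a u * relMetric x y u m i :=
    Finset.sum_congr rfl fun m _ => by rw [hsu i m]
  simp only [darboux, covDeriv₂, inner_sub_right, hdW, inner_sum, inner_smul_right, hW, hr,
    sum_christoffel_mul hdet hsu]
  rw [hsw _ k j, hsw _ k i, hsw _ j i]
  ring

/-- In `q A_ijk` the function `q` enters only through the symmetrization of `(1/2) (log q)_{/i}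
H_jk`. Tracing over `j, k` with `H⁻¹` yields the factor `n + 1 + 1`. The first summand is the same
for every normalization. -/
theorem tchebychev_conformal {H : E n → Matrix (Fin n) (Fin n) ℝ} {q : E n → ℝ} {ν : E (n + 1)}
    (hX : covector x y u = (q u)⁻¹ • ν) (hν : ∀ i, inner ℝ ν (pd i x u) = 0)
    (hQ : relMetric x y =ᶠ[nhds u] fun v => (q v)⁻¹ • H v)
    (hx : ContDiffAt ℝ 3 x u) (hq : ContDiffAt ℝ 2 q u)
    (hH : ∀ i j, ContDiffAt ℝ 2 (fun v => H v i j) u)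
    (h0 : q u ≠ 0) (hdet : (H u).det ≠ 0) (hs : ∀ᶠ v in nhds u, ∀ i j, H v i j = H v j i) :
    (q u)⁻¹ • tchebychev x y u =
      (1 / (n : ℝ)) • ∑ m, (∑ i, ∑ j, ∑ k, (inner ℝ ν (pd k (pd j (pd i x)) u) -
        (1 / 2) * (pd i (fun v => H v j k) u + pd j (fun v => H v i k) u +
          pd k (fun v => H v i j) u)) * (H u)⁻¹ j k * (H u)⁻¹ i m) • pd m x u +
      (((n : ℝ) + 2) / (2 * n)) • ∑ m, logGrad H q m u • pd m x u := by
  have hG (i j : Fin n) : ContDiffAt ℝ 2 (fun v => relMetric x y v i j) u :=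
    ((hq.inv h0).mul (hH i j)).congr_of_eventuallyEq (hQ.mono fun v hv => by simp [hv])
  have hsu := hs.self_of_nhds
  have hQu : (relMetric x y u)⁻¹ = q u • (H u)⁻¹ := by rw [hQ.eq_of_nhds, inv_smul_inv h0 hdet]
  have hGdet : (relMetric x y u).det ≠ 0 := by
    rw [hQ.eq_of_nhds, Matrix.det_smul]
    exact mul_ne_zero (pow_ne_zero _ (inv_ne_zero h0)) hdet
  have hA (i j k : Fin n) : q u * darboux x y i j k u = inner ℝ ν (pd k (pd j (pd i x)) u) -
      (1 / 2) * (pd i (fun v => H v j k) u + pd j (fun v => H v i k) u +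
        pd k (fun v => H v i j) u) +
      (1 / 2) * (q u)⁻¹ * (pd i q u * H u j k + pd j q u * H u i k + pd k q u * H u i j) := by
    rw [darboux_eq (fun i => by rw [hX, inner_smul_left, hν, mul_zero]) hx hG hGdet
      (by filter_upwards [hQ, hs] with v h1 h2 i j; simp [h1, h2 i j])]
    simp only [pd_conformal hQ (hq.differentiableAt (by norm_num))
      (fun a b => (hH a b).differentiableAt (by norm_num)) h0, hX, inner_smul_left, conj_trivial]
    field_simp
    ring
  have hL (m : Fin n) : ∑ i, ∑ j, ∑ k, (q u)⁻¹ *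
      (pd i q u * H u j k + pd j q u * H u i k + pd k q u * H u i j) *
        (H u)⁻¹ j k * (H u)⁻¹ i m = ((n : ℝ) + 2) * logGrad H q m u := by
    have e1 (i : Fin n) : ∑ j, ∑ k, (q u)⁻¹ *
        (pd i q u * H u j k + pd j q u * H u i k + pd k q u * H u i j) *
        (H u)⁻¹ j k * (H u)⁻¹ i m =
        ((n : ℝ) + 2) * ((H u)⁻¹ m i * ((q u)⁻¹ * pd i q u)) := by
      have a2 : ∑ j, ∑ k, pd j q u * ((H u)⁻¹ j k * H u i k) = pd i q u := by
        simp only [← Finset.mul_sum, sum_inv_mul' hdet hsu]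
        simp
      have a3 : ∑ j, ∑ k, pd k q u * ((H u)⁻¹ k j * H u i j) = pd i q u := by
        rw [Finset.sum_comm]
        exact a2
      calc _ = (q u)⁻¹ * (H u)⁻¹ m i * (pd i q u * (∑ j, ∑ k, (H u)⁻¹ j k * H u j k) +
            ∑ j, ∑ k, pd j q u * ((H u)⁻¹ j k * H u i k) +
            ∑ j, ∑ k, pd k q u * ((H u)⁻¹ k j * H u i j)) := by
            simp only [Finset.mul_sum, ← Finset.sum_add_distrib]
            refine Finset.sum_congr rfl fun j _ => Finset.sum_congr rfl fun k _ => ?_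
            rw [inv_apply_symm hsu i m, inv_apply_symm hsu k j]
            ring
        _ = _ := by
            rw [sum_sum_inv_mul hdet hsu, a2, a3]
            ring
    simp only [e1, logGrad, Finset.mul_sum]
  have hT : (q u)⁻¹ • tchebychev x y u = (1 / (n : ℝ)) • ∑ m, (∑ i, ∑ j, ∑ k,
      (q u * darboux x y i j k u) * (H u)⁻¹ j k * (H u)⁻¹ i m) • pd m x u := by
    rw [tchebychev, smul_comm]
    congr 1
    simp only [Finset.smul_sum, Finset.sum_smul, hQu, smul_smul, Matrix.smul_apply, smul_eq_mul]
    rw [Finset.sum_comm (γ := Fin n) (s := Finset.univ) (f := fun m i => ∑ j, ∑ k,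
      (q u * darboux x y i j k u * (H u)⁻¹ j k * (H u)⁻¹ i m) • pd m x u)]
    refine Finset.sum_congr rfl fun i _ => ?_
    rw [Finset.sum_comm (γ := Fin n) (s := Finset.univ) (f := fun m j => ∑ k,
      (q u * darboux x y i j k u * (H u)⁻¹ j k * (H u)⁻¹ i m) • pd m x u)]
    refine Finset.sum_congr rfl fun j _ => ?_
    rw [Finset.sum_comm (γ := Fin n) (s := Finset.univ) (f := fun m k =>
      (q u * darboux x y i j k u * (H u)⁻¹ j k * (H u)⁻¹ i m) • pd m x u)]
    refine Finset.sum_congr rfl fun k _ => Finset.sum_congr rfl fun m _ => ?_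
    congr 1
    field_simp
  -- This splitting needs no `n ≠ 0`: for `n = 0` both sides are zero.
  rw [hT, show ((n : ℝ) + 2) / (2 * n) = 1 / n * (((n : ℝ) + 2) / 2) by
    rw [div_mul_div_comm, one_mul, mul_comm (2 : ℝ)], mul_smul, ← smul_add,
    Finset.smul_sum (r := ((n : ℝ) + 2) / 2),
    ← Finset.sum_add_distrib]
  congr 1
  refine Finset.sum_congr rfl fun m _ => ?_
  rw [smul_smul, ← add_smul]
  congr 1
  rw [show ((n : ℝ) + 2) / 2 * logGrad H q m u = 1 / 2 * (((n : ℝ) + 2) * logGrad H q m u) by ring,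
    ← hL]
  simp only [hA, Finset.mul_sum, ← Finset.sum_add_distrib]
  refine Finset.sum_congr rfl fun i _ => Finset.sum_congr rfl fun j _ =>
    Finset.sum_congr rfl fun k _ => ?_
  ring

end Darboux

/-! Proportionality of two support functions in terms of their logarithmic gradients. -/

theorem pd_const_mul {q : E n → ℝ} {u : E n} (hq : DifferentiableAt ℝ q u) (c : ℝ) (i : Fin n) :
    pd i (fun v => c * q v) u = c * pd i q u := by
  simp only [pd]
  rw [fderiv_const_mul hq]
  simp

theorem logDeriv_eq_iff_proportional {U : Set (E n)} (hU : IsOpen U) (hU' : IsPreconnected U)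
    {q₁ q₂ : E n → ℝ} (hq₁ : ∀ u ∈ U, DifferentiableAt ℝ q₁ u)
    (hq₂ : ∀ u ∈ U, DifferentiableAt ℝ q₂ u) (h₁ : ∀ u ∈ U, q₁ u ≠ 0) (h₂ : ∀ u ∈ U, q₂ u ≠ 0) :
    (∀ u ∈ U, ∀ i, (q₁ u)⁻¹ * pd i q₁ u = (q₂ u)⁻¹ * pd i q₂ u) ↔
      ∃ c : ℝ, c ≠ 0 ∧ ∀ u ∈ U, q₁ u = c * q₂ u := by
  constructor
  · intro h
    obtain ⟨a, ha⟩ := hU.exists_is_const_of_fderiv_eq_zero hU'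
      (f := fun v => (q₂ v)⁻¹ * q₁ v)
      (fun u hu => (((hq₂ u hu).fun_inv (h₂ u hu)).mul (hq₁ u hu)).differentiableWithinAt)
      (fun u hu => by
        ext w
        rw [fderiv_eq_sum_pd]
        refine Finset.sum_eq_zero fun i _ => ?_
        have h0 := h u hu i
        have n1 := h₁ u hu
        have n2 := h₂ u hu
        field_simp at h0
        rw [pd_inv_mul (hq₂ u hu) (hq₁ u hu) n2]
        have : (q₂ u)⁻¹ * pd i q₁ u - (q₂ u)⁻¹ ^ 2 * pd i q₂ u * q₁ u = 0 := by
          field_simp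
          linarith
        rw [this, smul_zero])
    -- A point of `U` is needed to see that the constant `a` is nonzero.
    rcases U.eq_empty_or_nonempty with rfl | ⟨u, hu⟩
    · exact ⟨1, one_ne_zero, by simp⟩
    · refine ⟨a, ?_, fun v hv => ?_⟩
      · rw [← ha u hu]
        exact mul_ne_zero (inv_ne_zero (h₂ u hu)) (h₁ u hu)
      · rw [← ha v hv, mul_comm, mul_inv_cancel_left₀ (h₂ v hv)]
  · rintro ⟨c, hc, h⟩ u hu i
    have hev : q₁ =ᶠ[nhds u] fun v => c * q₂ v := by
      filter_upwards [hU.mem_nhds hu] with v hv using h v hv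
    rw [pd_congr hev, pd_const_mul (hq₂ u hu), h u hu]
    have := h₂ u hu
    field_simp

theorem sum_logGrad_mul {H : E n → Matrix (Fin n) (Fin n) ℝ} {q : E n → ℝ} {u : E n}
    (hdet : (H u).det ≠ 0) (hs : ∀ i j, H u i j = H u j i) (j : Fin n) :
    ∑ m, logGrad H q m u * H u m j = (q u)⁻¹ * pd j q u := by
  simp only [logGrad, Finset.sum_mul]
  rw [Finset.sum_comm]
  calc _ = ∑ l, (∑ m, (H u)⁻¹ l m * H u m j) * ((q u)⁻¹ * pd l q u) := by
        refine Finset.sum_congr rfl fun l _ => ?_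
        rw [Finset.sum_mul]
        refine Finset.sum_congr rfl fun m _ => ?_
        rw [inv_apply_symm hs m l]
        ring
    _ = _ := by simp [sum_inv_mul hdet]

/-- Pairing with `f_{/j}` lowers the index of the logarithmic gradients, leaving `-κ` times the
difference of logarithmic derivatives. Keeping `z` and `f` abstract serves both `(x, ξ)` and `(ξ,
x)`. -/
theorem innerDiffVanishes_iff_proportional {U : Set (E n)} (hU : IsOpen U)
    (hU' : IsPreconnected U) {H : E n → Matrix (Fin n) (Fin n) ℝ} {q₁ q₂ : E n → ℝ}
    {V z f : E n → E (n + 1)} {κ : ℝ} (hκ : κ ≠ 0) (hdet : ∀ u ∈ U, (H u).det ≠ 0)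
    (hs : ∀ u ∈ U, ∀ i j, H u i j = H u j i)
    (hzf : ∀ u ∈ U, ∀ i j, inner ℝ (pd i z u) (pd j f u) = -H u i j)
    (hq₁ : ∀ u ∈ U, DifferentiableAt ℝ q₁ u) (hq₂ : ∀ u ∈ U, DifferentiableAt ℝ q₂ u)
    (h₁ : ∀ u ∈ U, q₁ u ≠ 0) (h₂ : ∀ u ∈ U, q₂ u ≠ 0)
    (hV : ∀ u ∈ U, V u =
      κ • ∑ m, logGrad H q₁ m u • pd m z u - κ • ∑ m, logGrad H q₂ m u • pd m z u) :
    InnerDiffVanishes U V f ↔ ∃ c : ℝ, c ≠ 0 ∧ ∀ u ∈ U, q₁ u = c * q₂ u := by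
  rw [← logDeriv_eq_iff_proportional hU hU' hq₁ hq₂ h₁ h₂]
  have key (u : E n) (hu : u ∈ U) (j : Fin n) : inner ℝ (V u) (pd j f u) =
      -κ * ((q₁ u)⁻¹ * pd j q₁ u - (q₂ u)⁻¹ * pd j q₂ u) := by
    rw [hV u hu, ← sum_logGrad_mul (hdet u hu) (hs u hu), ← sum_logGrad_mul (hdet u hu) (hs u hu)]
    simp only [inner_sub_left, inner_smul_left, sum_inner, hzf u hu, conj_trivial, mul_neg,
      Finset.sum_neg_distrib]
    ring
  constructor
  · intro h u hu j
    have h0 : inner ℝ (V u) (pd j f u) = 0 := h u hu _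
    rw [key u hu, mul_eq_zero, neg_eq_zero] at h0
    exact sub_eq_zero.1 (h0.resolve_left hκ)
  · intro h u hu w
    rw [fderiv_eq_sum_pd, inner_sum]
    refine Finset.sum_eq_zero fun j _ => ?_
    rw [inner_smul_right, key u hu, h u hu, sub_self, mul_zero, mul_zero]

end RelGeom

/-! ### Invariance for `n = 2` and the equivalences for `n ≥ 3`. -/

theorem mainTheorem11 (n : ℕ) (r s : WithTop ℕ∞) (hs : 1 ≤ s) (hsr : s < r) (hr : 3 ≤ r)
    (U : Set (RelGeom.E n)) (hU : IsPreconnected U)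
    (x ξ : RelGeom.E n → RelGeom.E (n + 1))
    (hx : RelGeom.IsHypersurface r U x)
    (hξ : RelGeom.IsEuclideanNormalization U x ξ)
    (hK : ∀ u ∈ U, RelGeom.gaussCurvature x ξ u ≠ 0)
    (y₁ y₂ : RelGeom.E n → RelGeom.E (n + 1))
    (hy₁ : RelGeom.IsRelativeNormalization s U x y₁)
    (hy₂ : RelGeom.IsRelativeNormalization s U x y₂) :
    (n = 2 → ∀ u ∈ U,
      (RelGeom.support ξ y₁ u)⁻¹ • RelGeom.beltrami₂ (RelGeom.relMetric x y₁) x u =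
        (RelGeom.support ξ y₂ u)⁻¹ • RelGeom.beltrami₂ (RelGeom.relMetric x y₂) x u ∧
      (RelGeom.support ξ y₁ u)⁻¹ • RelGeom.beltrami₂ (RelGeom.relMetric x y₁) ξ u =
        (RelGeom.support ξ y₂ u)⁻¹ • RelGeom.beltrami₂ (RelGeom.relMetric x y₂) ξ u) ∧
    (3 ≤ n →
      (RelGeom.InnerDiffVanishes U
          (fun u =>
            (RelGeom.support ξ y₁ u)⁻¹ • RelGeom.beltrami₂ (RelGeom.relMetric x y₁) x u -
            (RelGeom.support ξ y₂ u)⁻¹ • RelGeom.beltrami₂ (RelGeom.relMetric x y₂) x u) ξ ↔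
        ∃ c : ℝ, c ≠ 0 ∧ ∀ u ∈ U, RelGeom.support ξ y₁ u = c * RelGeom.support ξ y₂ u) ∧
      (4 ≤ r →
        (RelGeom.InnerDiffVanishes U
            (fun u =>
              (RelGeom.support ξ y₁ u)⁻¹ • RelGeom.tchebychev x y₁ u -
              (RelGeom.support ξ y₂ u)⁻¹ • RelGeom.tchebychev x y₂ u) ξ ↔
          ∃ c : ℝ, c ≠ 0 ∧ ∀ u ∈ U, RelGeom.support ξ y₁ u = c * RelGeom.support ξ y₂ u)) ∧
      (RelGeom.InnerDiffVanishes U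
          (fun u =>
            (RelGeom.support ξ y₁ u)⁻¹ • RelGeom.beltrami₂ (RelGeom.relMetric x y₁) ξ u -
            (RelGeom.support ξ y₂ u)⁻¹ • RelGeom.beltrami₂ (RelGeom.relMetric x y₂) ξ u) x ↔
        ∃ c : ℝ, c ≠ 0 ∧ ∀ u ∈ U, RelGeom.support ξ y₁ u = c * RelGeom.support ξ y₂ u)) := by
  open RelGeom in
  have hU₀ := hx.isOpen
  have h2r : (2 : WithTop ℕ∞) ≤ r := le_trans (by norm_num) hr
  have hξ2 : ∀ u ∈ U, ContDiffAt ℝ 2 ξ u := fun u hu =>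
    contDiffAt_normal hx (by simpa [two_add_one_eq_three] using hr) hξ hu
      (firstForm_det_ne_zero (hK u hu))
  have hξd : ∀ u ∈ U, DifferentiableAt ℝ ξ u := fun u hu =>
    (hξ2 u hu).differentiableAt (by norm_num)
  have hdet : ∀ u ∈ U, (secondForm x ξ u).det ≠ 0 := fun u hu => secondForm_det_ne_zero (hK u hu)
  have hsym : ∀ u ∈ U, ∀ i j, secondForm x ξ u i j = secondForm x ξ u j i := fun u hu =>
    secondForm_symm ((hx.contDiffAt hu).of_le h2r)
  have hH : ∀ u ∈ U, ∀ i j, DifferentiableAt ℝ (fun v => secondForm x ξ v i j) u :=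
    fun u hu i j => (contDiffAt_secondForm (k := 1) (hx.contDiffAt hu)
      (by simpa [one_add_one_eq_two, two_add_one_eq_three] using hr)
      ((hξ2 u hu).of_le (by norm_num)) i j).differentiableAt (by norm_num)
  have hq2 {y : E n → E (n + 1)} (hy : IsRelativeNormalization s U x y) :
      ∀ u ∈ U, ContDiffAt ℝ 2 (support ξ y) u := fun u hu =>
    contDiffAt_support hU₀ hξ hs hy hu hξ2
  have hqd {y : E n → E (n + 1)} (hy : IsRelativeNormalization s U x y) :
      ∀ u ∈ U, DifferentiableAt ℝ (support ξ y) u := fun u hu =>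
    (hq2 hy u hu).differentiableAt (by norm_num)
  have hq0 {y : E n → E (n + 1)} (hy : IsRelativeNormalization s U x y) :
      ∀ u ∈ U, support ξ y u ≠ 0 := fun u hu => support_ne_zero hx hξ hy hu
  have hxξ : ∀ u ∈ U, ∀ i j, inner ℝ (pd i x u) (pd j ξ u) = -secondForm x ξ u i j :=
    fun u hu => inner_pd_pd_normal hx h2r hξ hu (hξd u hu)
  have hB {y : E n → E (n + 1)} (hy : IsRelativeNormalization s U x y) (f : E n → E (n + 1)) :
      ∀ u ∈ U, (support ξ y u)⁻¹ • beltrami₂ (relMetric x y) f u =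
        beltrami₂ (secondForm x ξ) f u + (-((n : ℝ) - 2) / 2) •
          ∑ m, logGrad (secondForm x ξ) (support ξ y) m u • pd m f u := fun u hu =>
    beltrami₂_conformal (relMetric_eventuallyEq hx hξ hy hu) (hqd hy u hu) (hH u hu)
      (hq0 hy u hu) (hdet u hu) (hsym u hu) f
  refine ⟨?_, fun hn => ?_⟩
  · rintro rfl u hu
    simp [hB hy₁ _ u hu, hB hy₂ _ u hu]
  have hn' : (3 : ℝ) ≤ n := by exact_mod_cast hn
  have hκ : -((n : ℝ) - 2) / 2 ≠ 0 := by
    intro h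
    linarith
  refine ⟨?_, fun hr4 => ?_, ?_⟩
  · refine innerDiffVanishes_iff_proportional hU₀ hU hκ hdet hsym hxξ (hqd hy₁) (hqd hy₂)
      (hq0 hy₁) (hq0 hy₂) fun u hu => ?_
    rw [hB hy₁ x u hu, hB hy₂ x u hu, add_sub_add_left_eq_sub]
  -- Here `r ≥ 4` enters: the Darboux tensor differentiates Christoffel symbols, so `h` must be
  -- `C^2`.
  · have hH2 : ∀ u ∈ U, ∀ i j, ContDiffAt ℝ 2 (fun v => secondForm x ξ v i j) u := fun u hu =>
      contDiffAt_secondForm (hx.contDiffAt hu)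
        (by simpa [two_add_one_eq_three, three_add_one_eq_four] using hr4) (hξ2 u hu)
    have hT {y : E n → E (n + 1)} (hy : IsRelativeNormalization s U x y) (u : E n) (hu : u ∈ U) :=
      tchebychev_conformal (covector_eq (hx.immersion u hu) (hξ.norm_eq_one u hu)
        (hξ.orthogonal u hu) (hq0 hy u hu)) (hξ.orthogonal u hu)
        (relMetric_eventuallyEq hx hξ hy hu) ((hx.contDiffAt hu).of_le hr) (hq2 hy u hu)
        (hH2 u hu) (hq0 hy u hu) (hdet u hu)
        (by filter_upwards [hU₀.mem_nhds hu] with v hv using hsym v hv)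
    refine innerDiffVanishes_iff_proportional hU₀ hU (κ := ((n : ℝ) + 2) / (2 * n))
      (by positivity) hdet hsym hxξ (hqd hy₁) (hqd hy₂) (hq0 hy₁) (hq0 hy₂) fun u hu => ?_
    rw [hT hy₁ u hu, hT hy₂ u hu, add_sub_add_left_eq_sub]
  -- The roles of `x` and `ξ` are exchanged; Weingarten's relation survives by symmetry of `h`.
  · refine innerDiffVanishes_iff_proportional hU₀ hU hκ hdet hsym
      (fun u hu i j => by rw [real_inner_comm, hxξ u hu, hsym u hu]) (hqd hy₁) (hqd hy₂)
      (hq0 hy₁) (hq0 hy₂) fun u hu => ?_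
    rw [hB hy₁ ξ u hu, hB hy₂ ξ u hu, add_sub_add_left_eq_sub]
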